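/- Let $n\ge 0$ and $m\ge 1$ be integers. Equip the holomorphic line bundle $\mathcal O(m)$ on $\mathbb{CP}^n$ with the Fubini–Study Hermitian metric, $|s|^2([Z])=|s(Z)|^2/|Z|^{2m}$ (a section $s$ being identified with a function on $\mathbb C^{n+1}\setminus\{0\}$ that is homogeneous of degree $m$), and with the associated Chern connection $\nabla$; in the affine chart $U_i=\{Z_i\neq 0\}$ with the frame $e_i=Z_i^m$ and $s=f e_i$ it is $\nabla s=(df-f\,\partial\varphi)\otimes e_i$, where $\varphi=m\log(1+|z|^2)$. A point $p$ is a critical point of $s\in H^0(\mathbb{CP}^n,\mathcal O(m))$ if $\nabla s(p)=0$; it is non-degenerate if moreover $s(p)\neq 0$ and the real Hessian of $\log|s|^2$ at $p$ is non-degenerate. There is a subset $S$ of Lebesgue measure zero of the finite-dimensional complex vector space $H^0(\mathbb{CP}^n,\mathcal O(m))$ such that for every $s\in H^0(\mathbb{CP}^n,\mathcal O(m))\setminus S$: 1. every critical point of $s$ is non-degenerate and is isolated in the set of critical points of $s$; 2. the function $|s|^2$ on $\mathbb{CP}^n$ is a generalized Morse (Morse–Bott) function: it is smooth, and each connected component $N$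 of its critical set is a non-degenerate critical manifold, i.e. $N$ is a connected embedded smooth submanifold of $\mathbb{CP}^n$ along which $d|s|^2=0$, and the Hessian of $|s|^2$ is non-degenerate on the normal bundle of $N$ (at each $p\in N$ the null space of the Hessian is $T_pN$). -/

import Mathlib

open scoped Topology ContDiff LinearAlgebra.Projectivization

noncomputable section

namespace FubiniStudy

/-! ### Complex projective space and its affine charts -/

/-- Nonzero vectors of `ℂ^{n+1}` (homogeneous coordinates). -/
abbrev Punctured (n : ℕ) : Type := {Z : Fin (n + 1) → ℂ // Z ≠ 0}

/-- Complex projective space `ℂPⁿ`, the lines through the origin of `ℂ^{n+1}`. -/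
abbrev CP (n : ℕ) : Type := ℙ ℂ (Fin (n + 1) → ℂ)

/-- The quotient topology from `ℂ^{n+1} ∖ {0}`. -/
instance instTopologicalSpaceCP (n : ℕ) : TopologicalSpace (CP n) :=
  TopologicalSpace.coinduced (fun Z : Punctured n => Projectivization.mk ℂ Z.1 Z.2) inferInstance

/-- The vector `(z₁, …, 1, …, zₙ)` with the `1` inserted at position `i`. -/
def affineLift {n : ℕ} (i : Fin (n + 1)) (z : Fin n → ℂ) : Punctured n :=
  ⟨i.insertNth (α := fun _ => ℂ) 1 z, fun h => by
    have := congrFun h i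
    simp at this⟩

/-- The inverse of the `i`-th affine chart: `ℂⁿ` is identified with `Uᵢ = {Zᵢ ≠ 0} ⊆ ℂPⁿ`.
These `n + 1` charts form the standard atlas of `ℂPⁿ`. -/
def affinePt {n : ℕ} (i : Fin (n + 1)) (z : Fin n → ℂ) : CP n :=
  Projectivization.mk ℂ (affineLift i z).1 (affineLift i z).2

/-! ### Holomorphic sections of `𝒪(m)` -/

/-- `H⁰(ℂPⁿ, 𝒪(m))`. The fibre of `𝒪(m)` over a line `ℓ` consists of the functions on `ℓ ∖ {0}`
that are homogeneous of degree `m`, so a section is a function on `ℂ^{n+1} ∖ {0}` that is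
homogeneous of degree `m`. Over `Uᵢ` the bundle has the frame `eᵢ = Zᵢ^m`, in which the section
is `z ↦ s (affineLift i z)`; the section is holomorphic if all of these functions are. -/
def H0 (n m : ℕ) : Submodule ℂ (Punctured n → ℂ) where
  carrier := {s | (∀ (c : ℂ) (hc : c ≠ 0) (Z : Punctured n),
      s ⟨c • Z.1, smul_ne_zero hc Z.2⟩ = c ^ m * s Z) ∧
    ∀ i, Differentiable ℂ fun z : Fin n → ℂ => s (affineLift i z)}
  add_mem' := by
    rintro s t ⟨hs, hs'⟩ ⟨ht, ht'⟩
    refine ⟨fun c hc Z => ?_, fun i => (hs' i).add (ht' i)⟩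
    simp only [Pi.add_apply, hs c hc Z, ht c hc Z, mul_add]
  zero_mem' := ⟨fun c hc Z => by simp, fun i => by simp⟩
  smul_mem' := by
    rintro a s ⟨hs, hs'⟩
    refine ⟨fun c hc Z => ?_, fun i => (hs' i).const_mul a⟩
    simp only [Pi.smul_apply, smul_eq_mul, hs c hc Z]
    ring

variable {n m : ℕ}

/-- The local expression `f` of `s = f eᵢ` over `Uᵢ`. -/
def localExpr (s : H0 n m) (i : Fin (n + 1)) (z : Fin n → ℂ) : ℂ := s.1 (affineLift i z)

theorem apply_eq_of_ne_zero (s : H0 n m) (i : Fin (n + 1)) (Z : Punctured n) (h : Z.1 i ≠ 0) :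
    s.1 Z = (Z.1 i) ^ m * localExpr s i (fun k => (Z.1 i)⁻¹ * Z.1 (i.succAbove k)) := by
  have key := s.2.1 (Z.1 i) h (affineLift i (fun k => (Z.1 i)⁻¹ * Z.1 (i.succAbove k)))
  rw [localExpr, ← key]
  refine congrArg s.1 (Subtype.ext ?_)
  funext j
  refine Fin.succAboveCases i ?_ (fun k => ?_) j
  · simp [affineLift]
  · simp [affineLift, h]

/-- An entire function of growth `O(|t|^m)` with `m + 1` zeros `0, …, m` vanishes. -/
theorem entire_eq_zero (m : ℕ) (g : ℂ → ℂ) (hg : Differentiable ℂ g) (C : ℝ)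
    (hC : ∀ t : ℂ, 1 ≤ ‖t‖ → ‖g t‖ ≤ C * ‖t‖ ^ m)
    (h0 : ∀ k : ℕ, k ≤ m → g k = 0) : g = 0 := by
  have hC0 : 0 ≤ C := by
    have := (norm_nonneg _).trans (hC 1 (by simp))
    simpa using this
  have hder : ∀ k, m < k → iteratedDeriv k g 0 = 0 := by
    intro k hk
    have hb : ∀ R : ℝ, 1 ≤ R → ‖iteratedDeriv k g 0‖ ≤ (k.factorial * C) / R := by
      intro R hR
      have hR0 : 0 < R := by linarith
      have := Complex.norm_iteratedDeriv_le_of_forall_mem_sphere_norm_le k hR0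
        (hg.diffContOnCl (s := Metric.ball (0 : ℂ) R)) (C := C * R ^ m) (fun z hz => by
          have hz' : ‖z‖ = R := by simpa using hz
          simpa [hz'] using hC z (by rw [hz']; exact hR))
      refine this.trans ?_
      rw [div_le_div_iff₀ (by positivity) hR0]
      have : R ^ m * R ≤ R ^ k := by
        rw [← pow_succ]
        exact pow_le_pow_right₀ hR hk
      calc (k.factorial : ℝ) * (C * R ^ m) * R = k.factorial * C * (R ^ m * R) := by ring
        _ ≤ k.factorial * C * R ^ k := by gcongr
    have hlim : Filter.Tendsto (fun R : ℝ => (k.factorial * C) / R) Filter.atTop (𝓝 0) :=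
      tendsto_const_nhds.div_atTop Filter.tendsto_id
    have hle : ‖iteratedDeriv k g 0‖ ≤ 0 := ge_of_tendsto hlim
      (Filter.eventually_atTop.2 ⟨1, fun R hR => hb R hR⟩)
    exact norm_le_zero_iff.1 hle
  let P : Polynomial ℂ := ∑ k ∈ Finset.range (m + 1),
    Polynomial.monomial k ((k.factorial : ℂ)⁻¹ * iteratedDeriv k g 0)
  have hP : ∀ t, g t = P.eval t := by
    intro t
    have h1 := Complex.taylorSeries_eq_of_entire' (c := 0) (z := t) hg
    rw [← h1, tsum_eq_sum (s := Finset.range (m + 1))]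
    · simp [P, Polynomial.eval_finsetSum]
    · intro k hk
      simp [hder k (by simpa using hk)]
  have hdeg : P.natDegree < m + 1 := by
    refine Nat.lt_succ_of_le (Polynomial.natDegree_sum_le_of_forall_le _ _ fun k hk => ?_)
    exact (Polynomial.natDegree_monomial_le _).trans (Nat.lt_succ_iff.1 (Finset.mem_range.1 hk))
  have hP0 : P = 0 := by
    refine Polynomial.eq_zero_of_natDegree_lt_card_of_eval_eq_zero P
      (f := fun k : Fin (m + 1) => ((k : ℕ) : ℂ)) ?_ ?_ (by simpa using hdeg)
    · intro a b hab
      exact Fin.ext (by simpa using hab)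
    · intro k
      rw [← hP]
      exact h0 k (Nat.lt_succ_iff.1 k.2)
  funext t
  simp [hP, hP0]

theorem localExpr_line_bound (s : H0 n m) (z : Fin n → ℂ) (j : Fin n) :
    ∃ C : ℝ, ∀ t : ℂ, 1 ≤ ‖t‖ → ‖localExpr s 0 (Function.update z j t)‖ ≤ C * ‖t‖ ^ m := by
  let Y : Fin (n + 1) → ℂ := (affineLift 0 (Function.update z j 0)).1
  have hcont : Continuous fun u : ℂ =>
      localExpr s j.succ (fun k => u * Y (j.succ.succAbove k)) :=
    (s.2.2 j.succ).continuous.comp (by fun_prop)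
  obtain ⟨C, hC⟩ := (isCompact_closedBall (0 : ℂ) 1).exists_bound_of_continuousOn
    hcont.continuousOn
  refine ⟨C, fun t ht => ?_⟩
  have ht0 : t ≠ 0 := fun h => by simp [h] at ht; linarith
  have hj : (affineLift 0 (Function.update z j t)).1 j.succ = t := by simp [affineLift]
  have h1 := apply_eq_of_ne_zero s j.succ (affineLift 0 (Function.update z j t))
    (by rw [hj]; exact ht0)
  have h2 : ∀ k, (affineLift 0 (Function.update z j t)).1 (j.succ.succAbove k)
      = Y (j.succ.succAbove k) := by
    intro k
    have hne := Fin.succAbove_ne j.succ k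
    generalize j.succ.succAbove k = l at hne
    refine Fin.cases ?_ (fun l' hne => ?_) l hne
    · intro _; rfl
    · have : l' ≠ j := fun h => hne (by rw [h])
      simp [Y, affineLift, this]
  simp only [hj, h2] at h1
  rw [localExpr, h1, norm_mul, norm_pow, mul_comm]
  gcongr
  apply hC
  rw [mem_closedBall_zero_iff, norm_inv]
  exact inv_le_one_of_one_le₀ ht

/-- `H⁰(ℂPⁿ, 𝒪(m))` is finite-dimensional, so that it carries a Lebesgue measure. -/
instance instFiniteDimensionalH0 (n m : ℕ) : FiniteDimensional ℂ (H0 n m) := by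
  let L : H0 n m →ₗ[ℂ] ((Fin n → Fin (m + 1)) → ℂ) :=
    { toFun := fun s a => localExpr s 0 (fun j => ((a j : ℕ) : ℂ))
      map_add' := fun s t => rfl
      map_smul' := fun c s => rfl }
  refine FiniteDimensional.of_injective L ((injective_iff_map_eq_zero L).2 fun s hs => ?_)
  have hgrid : ∀ A : Finset (Fin n), ∀ z : Fin n → ℂ,
      (∀ j, j ∉ A → ∃ k : ℕ, k ≤ m ∧ z j = k) → localExpr s 0 z = 0 := by
    intro A
    induction A using Finset.induction_on with
    | empty =>
      intro z hz
      choose a ha ha' using fun j => hz j (by simp)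
      have := congrFun hs (fun j => ⟨a j, Nat.lt_succ_of_le (ha j)⟩)
      have hz' : z = fun j => ((a j : ℕ) : ℂ) := funext ha'
      rw [hz']
      exact this
    | insert b A hb ih =>
      intro z hz
      obtain ⟨C, hC⟩ := localExpr_line_bound s z b
      have hd : Differentiable ℂ fun t : ℂ => localExpr s 0 (Function.update z b t) := by
        refine (s.2.2 0).comp (differentiable_pi.2 fun j => ?_)
        by_cases h : j = b
        · subst h; simp
        · simp [h]
      have := entire_eq_zero m _ hd C hC (fun k hk => ih _ fun j hj => by
        by_cases h : j = b
        · subst h; exact ⟨k, hk, by simp⟩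
        · simpa [h] using hz j (by simp [h, hj]))
      simpa using congrFun this (z b)
  have h0 : ∀ z, localExpr s 0 z = 0 := fun z => hgrid Finset.univ z (by simp)
  have h0' : ∀ Z : Punctured n, Z.1 0 ≠ 0 → s.1 Z = 0 := fun Z hZ => by
    rw [apply_eq_of_ne_zero s 0 Z hZ, h0, mul_zero]
  have hi : ∀ i z, localExpr s i z = 0 := by
    intro i z
    by_cases hi : i = 0
    · rw [hi]; exact h0 z
    obtain ⟨k, hk⟩ := Fin.exists_succAbove_eq (x := 0) (y := i) (Ne.symm hi)
    have hc : Continuous fun t : ℂ => localExpr s i (Function.update z k t) :=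
      (s.2.2 i).continuous.comp (continuous_const.update k continuous_id)
    have := Continuous.ext_on (dense_compl_singleton (0 : ℂ)) hc continuous_const
      (g := fun _ => (0 : ℂ)) (fun t ht => h0' _ (by
        have : (affineLift i (Function.update z k t)).1 (i.succAbove k) = t := by
          simp [affineLift]
        rw [hk] at this
        rw [this]
        exact ht))
    simpa using congrFun this (z k)
  apply Subtype.ext
  funext Z
  obtain ⟨i, hZ⟩ : ∃ i, Z.1 i ≠ 0 := by
    by_contra! h
    exact Z.2 (funext h)
  rw [apply_eq_of_ne_zero s i Z hZ, hi]
  simp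

/-- A subset of a finite-dimensional complex vector space has Lebesgue measure zero
(in linear coordinates; the choice of the coordinates does not matter). -/
def IsLebesgueNull {V : Type*} [AddCommGroup V] [Module ℂ V] [FiniteDimensional ℂ V]
    (S : Set V) : Prop :=
  MeasureTheory.volume ((Module.finBasis ℂ V).equivFun '' S) = 0

/-! ### The Fubini–Study metric and its connection -/

/-- The function `|s|²` on `ℂPⁿ` for the Fubini–Study metric of `𝒪(m)`:
`|s|²([Z]) = |s(Z)|² / |Z|^{2m}`. -/
def normSq (s : H0 n m) : CP n → ℝ :=
  Projectivization.lift (fun Z : Punctured n => ‖s.1 Z‖ ^ 2 / (∑ i, ‖Z.1 i‖ ^ 2) ^ m) (by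
    rintro ⟨a, ha⟩ ⟨b, hb⟩ t (h : a = t • b)
    subst h
    have ht : t ≠ 0 := fun h => ha (by simp [h])
    have ht' : (‖t‖ ^ 2) ^ m ≠ 0 := by positivity
    have h1 := s.2.1 t ht ⟨b, hb⟩
    simp only at h1
    simp only [h1, Pi.smul_apply, smul_eq_mul, norm_mul, norm_pow, mul_pow, ← Finset.mul_sum]
    rw [← pow_mul, mul_comm m 2, pow_mul, mul_div_mul_left _ _ ht'])

/-- The Fubini–Study potential `φ = m log (1 + |z|²)` on an affine chart: `|eᵢ|² = e^{-φ}`. -/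
def potential (m : ℕ) (z : Fin n → ℂ) : ℝ := m * Real.log (1 + ∑ j, ‖z j‖ ^ 2)

/-- The `(1,0)`-part `∂g = (dg - i dg ∘ J) / 2` of the differential of a real function `g` at `z`,
evaluated at the tangent vector `v`. -/
def del (g : (Fin n → ℂ) → ℝ) (z v : Fin n → ℂ) : ℂ :=
  ((fderiv ℝ g z v : ℂ) - Complex.I * (fderiv ℝ g z (Complex.I • v) : ℂ)) / 2

/-- The Fubini–Study (Chern) connection: over `Uᵢ`, `∇s = (df - f ∂φ) ⊗ eᵢ`. This is the
coefficient of `eᵢ` in `∇_v s` at the point with affine coordinates `z`. -/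
def nabla (s : H0 n m) (i : Fin (n + 1)) (z v : Fin n → ℂ) : ℂ :=
  fderiv ℝ (localExpr s i) z v - localExpr s i z * del (potential m) z v

/-- `p` is a critical point of the section `s`: `∇s = 0` at `p`. -/
def IsCriticalPoint (s : H0 n m) (p : CP n) : Prop :=
  ∀ i z, affinePt i z = p → ∀ v, nabla s i z v = 0

/-- The critical point `p` of `s` is isolated in the set of critical points of `s`. -/
def IsIsolatedCritical (s : H0 n m) (p : CP n) : Prop :=
  ∃ U ∈ 𝓝 p, ∀ q ∈ U, IsCriticalPoint s q → q = p

/-! ### Hessians, and generalized Morse functions on `ℂPⁿ` -/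

/-- The expression of a function on `ℂPⁿ` in the `i`-th affine chart. -/
def inChart (f : CP n → ℝ) (i : Fin (n + 1)) (z : Fin n → ℂ) : ℝ := f (affinePt i z)

/-- The Hessian of `f` in the `i`-th affine chart (the `2n` real second partial derivatives); at a
critical point of `f` it is, as a bilinear form on the tangent space, independent of the chart. -/
def hessian (f : CP n → ℝ) (i : Fin (n + 1)) (z v w : Fin n → ℂ) : ℝ :=
  fderiv ℝ (fderiv ℝ (inChart f i)) z v w

/-- `p` is a non-degenerate critical point of the section `s`: `∇s = 0` at `p`, `s(p) ≠ 0`, and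
the real Hessian of `log |s|²` at `p` is non-degenerate. -/
def IsNondegenerateCritical (s : H0 n m) (p : CP n) : Prop :=
  IsCriticalPoint s p ∧ normSq s p ≠ 0 ∧
    ∀ i z, affinePt i z = p →
      ∀ v, (∀ w, hessian (fun q => Real.log (normSq s q)) i z v w = 0) → v = 0

/-- The set of critical points of a (smooth) function `f` on `ℂPⁿ`. -/
def critSet (f : CP n → ℝ) : Set (CP n) :=
  {p | ∀ i z, affinePt i z = p → fderiv ℝ (inChart f i) z = 0}

/-- `S ⊆ ℂⁿ = ℝ²ⁿ` is near its point `z` an embedded smooth real submanifold with tangent space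
`T` at `z`: some smooth local diffeomorphism `Φ` around `z` straightens `S` to a
real linear subspace `W`, and `T = (dΦ_z)⁻¹ W`. -/
def IsSubmanifoldAt (S : Set (Fin n → ℂ)) (z : Fin n → ℂ) (T : Submodule ℝ (Fin n → ℂ)) : Prop :=
  ∃ (Φ : OpenPartialHomeomorph (Fin n → ℂ) (Fin n → ℂ)) (W : Submodule ℝ (Fin n → ℂ)),
    z ∈ S ∧ z ∈ Φ.source ∧ ContDiffOn ℝ ∞ Φ Φ.source ∧ ContDiffOn ℝ ∞ Φ.symm Φ.target ∧
    (∀ x ∈ Φ.source, x ∈ S ↔ Φ x ∈ W) ∧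
    T = W.comap (fderiv ℝ Φ z).toLinearMap

/-- `N` is a non-degenerate critical manifold of `f`: a connected embedded submanifold of `ℂPⁿ`
along which `df = 0` and the Hessian is non-degenerate on the normal bundle `TℂPⁿ|_N / TN`, that
is, the null space of the Hessian of `f` at each point of `N` is the tangent space of `N`. -/
def IsNondegenerateCriticalManifold (f : CP n → ℝ) (N : Set (CP n)) : Prop :=
  IsConnected N ∧ N ⊆ critSet f ∧
    ∀ i z, affinePt i z ∈ N → ∃ T : Submodule ℝ (Fin n → ℂ),
      IsSubmanifoldAt (affinePt i ⁻¹' N) z T ∧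
      ∀ v, (∀ w, hessian f i z v w = 0) ↔ v ∈ T

/-- `f` is a generalized Morse (Morse–Bott) function on `ℂPⁿ`: it is smooth and its critical set
is a disjoint union of non-degenerate critical manifolds, its connected components. -/
def IsGeneralizedMorse (f : CP n → ℝ) : Prop :=
  (∀ i, ContDiff ℝ ∞ (inChart f i)) ∧
    ∀ p ∈ critSet f, IsNondegenerateCriticalManifold f (connectedComponentIn (critSet f) p)

end FubiniStudy

end

/-!
Over an affine chart write `s = f eᵢ` and `∇s = (df - f ∂φ) ⊗ eᵢ`, so that `|s|² = |f|² e^{-φ}`.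
Since `f` is holomorphic, `d|s|² = Re (2 e^{-φ} f̄ ∇s)`, and the critical set of `|s|²` is the union
of `{f = 0}` and `{∇s = 0}`. The 1-jet `(f, ∇s)` at a point depends linearly on `s`, and it takes
every value already on the sections `Zᵢ^{m-1} (∑ aⱼ Zⱼ + b Zᵢ)`, which exist because `m ≥ 1`.
Parametric transversality therefore shows that, for almost every `s`, the jet has no zeros and the
differential of `∇s` is bijective at each zero of `∇s`. For such `s` the zeros of `∇s` are isolated,
`df ≠ 0` on `{f = 0}`, and one more differentiation of the formula for `d|s|²` identifies the null
space of the Hessian with `ker df` on `{f = 0}` and with `0` on `{∇s = 0}`.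
-/

noncomputable section

namespace FubiniStudy

section Transversality

open MeasureTheory Module Function

variable {E V W : Type*} [NormedAddCommGroup E] [NormedSpace ℝ E]
  [NormedAddCommGroup V] [NormedSpace ℝ V] [NormedAddCommGroup W] [NormedSpace ℝ W]

theorem addHaar_image_eq_zero_of_not_surjective [FiniteDimensional ℝ E]
    [FiniteDimensional ℝ V] [MeasurableSpace V] [BorelSpace V]
    (μ : Measure V) [μ.IsAddHaarMeasure] (hdim : finrank ℝ E ≤ finrank ℝ V)
    {f : E → V} {f' : E → E →L[ℝ] V} {s : Set E}
    (hf : ∀ x ∈ s, HasFDerivWithinAt f (f' x) s x) (hf' : ∀ x ∈ s, ¬ Surjective (f' x)) :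
    μ (f '' s) = 0 := by
  obtain ⟨ι, hι⟩ := finrank_le_iff_exists_linearMap.1 hdim
  obtain ⟨π₀, hπ₀⟩ := ι.exists_leftInverse_of_injective (LinearMap.ker_eq_bot.2 hι)
  let π : V →L[ℝ] E := π₀.toContinuousLinearMap
  have hπ : Surjective π := fun x => ⟨ι x, LinearMap.congr_fun hπ₀ x⟩
  have himage : f '' s = (f ∘ π) '' (π ⁻¹' s) := by
    rw [Set.image_comp, Set.image_preimage_eq s hπ]
  rw [himage]
  refine addHaar_image_eq_zero_of_det_fderivWithin_eq_zero μ
    (f' := fun y => (f' (π y)).comp π)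
    (fun y hy => (hf _ hy).comp y π.hasFDerivWithinAt (Set.mapsTo_preimage π s)) fun y hy => ?_
  by_contra hdet
  refine hf' _ hy (Surjective.of_comp (g := π) ?_)
  exact (LinearMap.equivOfDetNeZero _ hdet).surjective

variable {P : E → V →L[ℝ] W}

theorem exists_differentiable_param_of_ker [FiniteDimensional ℝ W] (hP : ContDiff ℝ 1 P) {z₀ : E}
    (hz₀ : Surjective (P z₀)) :
    ∃ U ∈ 𝓝 z₀, ∃ Γ : (P z₀).ker × E → V,
      (∀ y, y.2 ∈ U → DifferentiableAt ℝ Γ y ∧ ∀ᶠ y' in 𝓝 y, P y'.2 (Γ y') = 0) ∧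
      ∀ z ∈ U, ∀ x, P z x = 0 → ∃ k, Γ (k, z) = x := by
  obtain ⟨R, hR⟩ := (P z₀).exists_rightInverse_of_surjective (LinearMap.range_eq_top.2 hz₀)
  have hPR : ContDiff ℝ 1 fun z => (P z).comp R := hP.clm_comp contDiff_const
  let U : Set E := {z | ((P z).comp R).IsInvertible}
  have hU : IsOpen U := ContinuousLinearEquiv.isOpen.preimage hPR.continuous
  let Γ : (P z₀).ker × E → V := fun y => y.1 - R (((P y.2).comp R).inverse (P y.2 y.1))
  refine ⟨U, hU.mem_nhds ?_, Γ, fun y hy => ⟨?_, ?_⟩, fun z hz x hx => ?_⟩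
  · change ((P z₀).comp R).IsInvertible
    rw [hR]
    exact ⟨ContinuousLinearEquiv.refl ℝ W, rfl⟩
  · have hinv := ((ContinuousLinearMap.IsInvertible.contDiffAt_map_inverse hy).comp y.2
      hPR.contDiffAt).comp (n := 1) y contDiffAt_snd
    have hval : ContDiffAt ℝ 1 (fun y : (P z₀).ker × E => P y.2 y.1) y :=
      (hP.contDiffAt.comp y contDiffAt_snd).clm_apply
        ((P z₀).ker.subtypeL.contDiff.contDiffAt.comp y contDiffAt_fst)
    have hΓ := ((P z₀).ker.subtypeL.contDiff.contDiffAt.comp y contDiffAt_fst).sub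
      (R.contDiff.contDiffAt.comp y (hinv.clm_apply hval))
    exact hΓ.differentiableAt one_ne_zero
  · filter_upwards [(hU.preimage continuous_snd).mem_nhds hy] with y' hy'
    rw [map_sub, sub_eq_zero]
    exact (ContinuousLinearMap.IsInvertible.self_apply_inverse hy' _).symm
  · have hk : x - R (P z₀ x) ∈ (P z₀).ker := by
      have hsection : P z₀ (R (P z₀ x)) = P z₀ x := DFunLike.congr_fun hR _
      simp [hsection]
    refine ⟨⟨_, hk⟩, ?_⟩
    have hinverse : ((P z).comp R).inverse (P z (R (P z₀ x))) = P z₀ x :=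
      ContinuousLinearMap.IsInvertible.inverse_apply_self hz _
    simp [Γ, hx, hinverse]

/-- Differentiating `P z (Γ y) = 0` expresses `∂_z (P z x)` through `P z ∘ DΓ`. -/
theorem surjective_fderiv_apply_of_surjective_fderiv_param {K : Type*} [NormedAddCommGroup K]
    [NormedSpace ℝ K] {Γ : K × E → V} {y : K × E} (hP : DifferentiableAt ℝ P y.2)
    (hy : Surjective (P y.2)) (hΓ : DifferentiableAt ℝ Γ y)
    (hzero : ∀ᶠ y' in 𝓝 y, P y'.2 (Γ y') = 0)
    (hsurj : Surjective (fderiv ℝ Γ y)) : Surjective (fderiv ℝ (fun z => P z (Γ y)) y.2) := by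
  have hderiv := (hP.hasFDerivAt.comp y hasFDerivAt_snd).clm_apply hΓ.hasFDerivAt
  have hderiv0 := hderiv.unique ((hasFDerivAt_const (0 : W) y).congr_of_eventuallyEq hzero)
  intro w
  obtain ⟨x, hx⟩ := hy (-w)
  obtain ⟨v, rfl⟩ := hsurj x
  refine ⟨v.2, ?_⟩
  rw [(hP.hasFDerivAt.clm_apply (hasFDerivAt_const (Γ y) y.2)).fderiv]
  have hsum : P y.2 (fderiv ℝ Γ y v) + fderiv ℝ P y.2 v.2 (Γ y) = 0 := DFunLike.congr_fun hderiv0 v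
  rw [hx, neg_add_eq_zero] at hsum
  simpa using hsum.symm

theorem ae_surjective_fderiv_of_apply_eq_zero [FiniteDimensional ℝ E] [FiniteDimensional ℝ V]
    [FiniteDimensional ℝ W] [MeasurableSpace V] [BorelSpace V] (μ : Measure V)
    [μ.IsAddHaarMeasure] (hP : ContDiff ℝ 1 P)
    (hsurj : ∀ z, Surjective (P z)) (hdim : finrank ℝ E ≤ finrank ℝ W) :
    ∀ᵐ x ∂μ, ∀ z, P z x = 0 → Surjective (fderiv ℝ (fun z => P z x) z) := by
  have hlocal : ∀ z₀, ∃ U ∈ 𝓝 z₀, ∀ᵐ x ∂μ, ∀ z ∈ U, P z x = 0 →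
      Surjective (fderiv ℝ (fun z => P z x) z) := by
    intro z₀
    obtain ⟨U, hU, Γ, hΓ, hcover⟩ := exists_differentiable_param_of_ker hP (hsurj z₀)
    have hrank : finrank ℝ ((P z₀).ker × E) ≤ finrank ℝ V := by
      have := (P z₀).toLinearMap.finrank_range_add_finrank_ker
      rw [LinearMap.range_eq_top.2 (hsurj z₀), finrank_top] at this
      rw [finrank_prod]
      lia
    have hnull := addHaar_image_eq_zero_of_not_surjective μ hrank
      (s := {y | y.2 ∈ U ∧ ¬ Surjective (fderiv ℝ Γ y)})
      (fun y hy => (hΓ y hy.1).1.hasFDerivAt.hasFDerivWithinAt) fun y hy => hy.2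
    refine ⟨U, hU, measure_mono_null (fun x hx => ?_) hnull⟩
    simp only [Set.mem_compl_iff, Set.mem_ofPred_eq, not_forall] at hx
    obtain ⟨z, hz, hx, hns⟩ := hx
    obtain ⟨k, rfl⟩ := hcover z hz x hx
    refine ⟨(k, z), ⟨hz, fun h => hns ?_⟩, rfl⟩
    exact surjective_fderiv_apply_of_surjective_fderiv_param
      (hP.differentiable one_ne_zero _) (hsurj z) (hΓ (k, z) hz).1 (hΓ (k, z) hz).2 h
  choose U hU hUae using hlocal
  obtain ⟨t, ht, htU⟩ := TopologicalSpace.countable_cover_nhds hU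
  filter_upwards [(ae_ball_iff ht).2 fun z₀ _ => hUae z₀] with x hx z
  obtain ⟨z₀, hz₀, hz⟩ := Set.mem_iUnion₂.1 (htU.ge (Set.mem_univ z))
  exact hx z₀ hz₀ z hz

end Transversality

section LebesgueNull

open MeasureTheory Module Function

variable {V : Type*} [AddCommGroup V] [Module ℂ V] [FiniteDimensional ℂ V]

theorem IsLebesgueNull.mono {S T : Set V} (hT : IsLebesgueNull T) (hST : S ⊆ T) :
    IsLebesgueNull S :=
  measure_mono_null (Set.image_mono hST) hT

theorem IsLebesgueNull.union {S T : Set V} (hS : IsLebesgueNull S) (hT : IsLebesgueNull T) :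
    IsLebesgueNull (S ∪ T) := by
  rw [IsLebesgueNull, Set.image_union]
  exact measure_union_null hS hT

theorem IsLebesgueNull.iUnion {ι : Type*} [Countable ι] {S : ι → Set V}
    (hS : ∀ i, IsLebesgueNull (S i)) : IsLebesgueNull (⋃ i, S i) := by
  rw [IsLebesgueNull, Set.image_iUnion]
  exact measure_iUnion_null hS

theorem isLebesgueNull_not_surjective_fderiv {E W : Type*} [NormedAddCommGroup E] [NormedSpace ℝ E]
    [FiniteDimensional ℝ E] [NormedAddCommGroup W] [NormedSpace ℝ W] [NormedSpace ℂ W]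
    [IsScalarTower ℝ ℂ W] [FiniteDimensional ℝ W] {P : E → V →ₗ[ℂ] W}
    (hP : ∀ s, ContDiff ℝ 1 fun z => P z s) (hsurj : ∀ z, Surjective (P z))
    (hdim : finrank ℝ E ≤ finrank ℝ W) :
    IsLebesgueNull {s | ¬ ∀ z, P z s = 0 → Surjective (fderiv ℝ (fun z => P z s) z)} := by
  let e := (finBasis ℂ V).equivFun
  let Q : E → (Fin (finrank ℂ V) → ℂ) →L[ℝ] W := fun z =>
    ((P z ∘ₗ e.symm.toLinearMap).restrictScalars ℝ).toContinuousLinearMap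
  have hQ : ContDiff ℝ 1 Q := contDiff_clm_apply_iff.2 fun x => hP (e.symm x)
  have hae := ae_surjective_fderiv_of_apply_eq_zero volume hQ
    (fun z => (hsurj z).comp e.symm.surjective) hdim
  refine measure_mono_null ?_ hae
  rintro _ ⟨s, hs, rfl⟩ h
  have hQs : (fun z => Q z (e s)) = fun z => P z s :=
    funext fun z => congrArg (P z) (e.symm_apply_apply s)
  exact hs fun z hz => hQs ▸ h z ((congrFun hQs z).trans hz)

end LebesgueNull

section Osgood

open MeasureTheory

variable {E F : Type*} [NormedAddCommGroup E] [NormedSpace ℂ E] [FiniteDimensional ℂ E]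
  [NormedAddCommGroup F] [NormedSpace ℂ F] {f : E → F}

theorem exists_norm_fderiv_le_of_isCompact (hf : Differentiable ℂ f) {K : Set E}
    (hK : IsCompact K) : ∃ C, ∀ x ∈ K, ‖fderiv ℂ f x‖ ≤ C := by
  obtain ⟨C, hC⟩ :=
    (hK.cthickening (r := 1)).exists_bound_of_continuousOn hf.continuous.continuousOn
  refine ⟨(C + C) / 1, fun x hx => Complex.norm_fderiv_le_div_of_mapsTo_ball
    hf.differentiableOn (fun y hy => ?_) one_pos⟩
  rw [mem_closedBall_iff_norm]
  exact (norm_sub_le _ _).trans (add_le_add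
    (hC y (Metric.closedBall_subset_cthickening hx 1 (Metric.ball_subset_closedBall hy)))
    (hC x (Metric.self_subset_cthickening K hx)))

variable [FiniteDimensional ℂ F]

theorem differentiable_intervalIntegral_smul_translate (hf : Differentiable ℂ f) {c : ℝ → ℂ}
    {u : ℝ → E} (hc : Continuous c) (hu : Continuous u) (a b : ℝ) :
    Differentiable ℂ fun z => ∫ t in a..b, c t • f (z + u t) := by
  intro z₀
  borelize E
  borelize F
  let K : Set E := (fun p : E × ℝ => p.1 + u p.2) '' Metric.closedBall z₀ 1 ×ˢ Set.uIcc a b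
  have hK : IsCompact K :=
    ((isCompact_closedBall z₀ 1).prod isCompact_uIcc).image (by fun_prop)
  obtain ⟨C, hC⟩ := exists_norm_fderiv_le_of_isCompact hf hK
  have hcont (z : E) : Continuous fun t => c t • f (z + u t) :=
    hc.smul (hf.continuous.comp (continuous_const.add hu))
  have hmeas : Measurable fun t => fderiv ℂ f (z₀ + u t) :=
    (measurable_fderiv ℂ f).comp (continuous_const.add hu).measurable
  refine (intervalIntegral.hasFDerivAt_integral_of_dominated_of_fderiv_le
    (F' := fun z t => c t • fderiv ℂ f (z + u t)) (bound := fun t => ‖c t‖ * C)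
    (Metric.closedBall_mem_nhds z₀ one_pos)
    (.of_forall fun z => (hcont z).aestronglyMeasurable) ((hcont z₀).intervalIntegrable a b)
    (hc.aestronglyMeasurable.smul hmeas.aestronglyMeasurable)
    (.of_forall fun t ht z hz => ?_) ((hc.norm.mul continuous_const).intervalIntegrable a b)
    (.of_forall fun t _ z _ => ?_)).differentiableAt
  · rw [norm_smul]
    gcongr
    exact hC _ ⟨(z, t), ⟨hz, Set.uIoc_subset_uIcc ht⟩, rfl⟩
  · exact (((hf (z + u t)).hasFDerivAt.comp z ((hasFDerivAt_id z).add_const (u t))).const_smul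
      (c t))

theorem differentiable_fderiv_apply (hf : Differentiable ℂ f) (v : E) :
    Differentiable ℂ fun z => fderiv ℂ f z v := by
  have hcauchy (z : E) : fderiv ℂ f z v = (2 * Real.pi * Complex.I : ℂ)⁻¹ •
      ∫ θ in (0 : ℝ)..2 * Real.pi, (deriv (circleMap 0 1) θ * (1 / (circleMap 0 1 θ) ^ 2)) •
        f (z + circleMap 0 1 θ • v) := by
    have hline : Differentiable ℂ fun t : ℂ => f (z + t • v) := by fun_prop
    have h := hline.differentiableOn.deriv_eq_smul_circleIntegral (c := 0) one_pos
    rw [← (hf z).lineDeriv_eq_fderiv, lineDeriv, eq_inv_smul_iff₀ Complex.two_pi_I_ne_zero, ← h,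
      circleIntegral]
    simp only [sub_zero, mul_smul]
  have hcircle : Continuous fun θ => deriv (circleMap 0 1) θ * (1 / (circleMap 0 1 θ) ^ 2) := by
    simp only [deriv_circleMap, one_div]
    exact ((continuous_circleMap 0 1).mul continuous_const).mul
      (((continuous_circleMap 0 1).pow 2).inv₀ fun θ => by simp)
  rw [funext hcauchy]
  exact (differentiable_intervalIntegral_smul_translate hf hcircle
    ((continuous_circleMap 0 1).smul continuous_const) _ _).const_smul _

/-- A weak form of Osgood's lemma: Cauchy's formula on complex lines shows that the derivative of
`f` in a fixed direction is again differentiable. -/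
theorem contDiff_of_differentiable (hf : Differentiable ℂ f) : ContDiff ℂ ∞ f := by
  refine contDiff_infty.2 fun n => ?_
  induction n generalizing f with
  | zero => exact contDiff_zero.2 hf.continuous
  | succ n ih =>
    refine contDiff_succ_iff_fderiv_apply.2 ⟨hf, fun h => ?_, fun v =>
      ih (differentiable_fderiv_apply hf v)⟩
    exact absurd h (by simp)

end Osgood

section Submanifolds

open Function

theorem exists_openPartialHomeomorph_contDiffOn_symm {E F : Type*} [NormedAddCommGroup E]
    [NormedSpace ℝ E] [CompleteSpace E] [NormedAddCommGroup F] [NormedSpace ℝ F] {G : E → F}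
    (hG : ContDiff ℝ ∞ G) {z : E} {e : E ≃L[ℝ] F} (hz : HasFDerivAt G (e : E →L[ℝ] F) z) :
    ∃ Φ : OpenPartialHomeomorph E F, ⇑Φ = G ∧ z ∈ Φ.source ∧ ContDiffOn ℝ ∞ Φ.symm Φ.target := by
  let Φ₀ := hG.contDiffAt.toOpenPartialHomeomorph G hz (by simp)
  let U : Set E := fderiv ℝ G ⁻¹' Set.range ((↑) : (E ≃L[ℝ] F) → E →L[ℝ] F)
  have hU : IsOpen U := ContinuousLinearEquiv.isOpen.preimage (hG.continuous_fderiv (by simp))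
  refine ⟨Φ₀.restrOpen U hU, rfl, ⟨hG.contDiffAt.mem_toOpenPartialHomeomorph_source hz (by simp),
    ⟨e, hz.fderiv.symm⟩⟩, fun y hy => ?_⟩
  obtain ⟨e', he'⟩ := ((Φ₀.restrOpen U hU).map_target hy).2
  refine ((Φ₀.restrOpen U hU).contDiffAt_symm hy (f₀' := e') ?_ hG.contDiffAt).contDiffWithinAt
  rw [he']
  exact (hG.differentiable (by simp) _).hasFDerivAt

variable {n : ℕ} {S S' : Set (Fin n → ℂ)} {z : Fin n → ℂ} {T : Submodule ℝ (Fin n → ℂ)}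

theorem IsSubmanifoldAt.congr (h : IsSubmanifoldAt S z T) (hS : S =ᶠ[𝓝 z] S') :
    IsSubmanifoldAt S' z T := by
  obtain ⟨Φ, W, hz, hzΦ, hΦ, hsymm, hW, rfl⟩ := h
  obtain ⟨U, hUS, hU, hzU⟩ := eventually_nhds_iff.1 hS.mem_iff
  exact ⟨Φ.restrOpen U hU, W, (hUS z hzU).1 hz, ⟨hzΦ, hzU⟩, hΦ.mono Set.inter_subset_left,
    hsymm.mono Set.inter_subset_left, fun x hx => (hUS x hx.2).symm.trans (hW x hx.1), rfl⟩

/-- With `R` a right inverse of `ℓ = dF z`, the map `x ↦ x + R (F x - ℓ x)` straightens `{F = 0}`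
to `ker ℓ`. -/
theorem isSubmanifoldAt_zeroSet {H : Type*} [NormedAddCommGroup H] [NormedSpace ℝ H]
    [FiniteDimensional ℝ H] {F : (Fin n → ℂ) → H} (hF : ContDiff ℝ ∞ F) (hz : F z = 0)
    (hsurj : Surjective (fderiv ℝ F z)) :
    IsSubmanifoldAt {x | F x = 0} z (fderiv ℝ F z).ker := by
  set ℓ := fderiv ℝ F z
  obtain ⟨R, hR⟩ := ℓ.exists_rightInverse_of_surjective (LinearMap.range_eq_top.2 hsurj)
  have hℓR (w : H) : ℓ (R w) = w := DFunLike.congr_fun hR w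
  let G : (Fin n → ℂ) → (Fin n → ℂ) := fun x => x + R (F x - ℓ x)
  have hG : ContDiff ℝ ∞ G := contDiff_id.add (R.contDiff.comp (hF.sub ℓ.contDiff))
  have hGz : HasFDerivAt G (ContinuousLinearEquiv.refl ℝ (Fin n → ℂ) : _ →L[ℝ] _) z := by
    have hFz : HasFDerivAt F ℓ z := (hF.differentiable (by simp) z).hasFDerivAt
    refine ((hasFDerivAt_id z).add
      (R.hasFDerivAt.comp z (hFz.sub ℓ.hasFDerivAt))).congr_fderiv ?_
    ext1 v
    simp
  have hℓG (x) : ℓ (G x) = F x := by simp only [G, map_add, hℓR, add_sub_cancel]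
  obtain ⟨Φ, hΦ, hzΦ, hsymm⟩ := exists_openPartialHomeomorph_contDiffOn_symm hG hGz
  refine ⟨Φ, ℓ.ker, hz, hzΦ, hΦ ▸ hG.contDiffOn, hsymm, fun x _ => ?_, ?_⟩
  · rw [hΦ, LinearMap.mem_ker]
    exact (congrArg (· = 0) (hℓG x)).symm.to_iff
  · rw [hΦ, hGz.fderiv]
    rfl

theorem IsSubmanifoldAt.preimage_connectedComponentIn {X : Type*} [TopologicalSpace X]
    {g : (Fin n → ℂ) → X} (hg : Continuous g) {C : Set X} (h : IsSubmanifoldAt (g ⁻¹' C) z T) :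
    IsSubmanifoldAt (g ⁻¹' connectedComponentIn C (g z)) z T := by
  refine h.congr (Filter.eventuallyEq_set.2 ?_)
  obtain ⟨Φ, W, hz, hzΦ, -, -, hW, -⟩ := h
  obtain ⟨r, hr, hball⟩ := Metric.isOpen_iff.1 Φ.open_target (Φ z) (Φ.map_source hzΦ)
  let D : Set (Fin n → ℂ) := Φ.symm '' (Metric.ball (Φ z) r ∩ W)
  have hD : IsPreconnected (g '' D) :=
    ((((convex_ball (Φ z) r).inter W.convex).isPreconnected.image _ (Φ.continuousOn_symm.mono
      fun _ hy => hball hy.1)).image _ hg.continuousOn)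
  have hDC : g '' D ⊆ C := by
    rintro _ ⟨_, ⟨y, ⟨hy, hyW⟩, rfl⟩, rfl⟩
    exact (hW _ (Φ.map_target (hball hy))).2 ((Φ.right_inv (hball hy)).symm ▸ hyW)
  have hmemD {x} (hx : x ∈ Φ.source) (hxr : Φ x ∈ Metric.ball (Φ z) r) (hxC : g x ∈ C) : x ∈ D :=
    ⟨Φ x, ⟨hxr, (hW x hx).1 hxC⟩, Φ.left_inv hx⟩
  have hzD : g z ∈ g '' D := ⟨z, hmemD hzΦ (Metric.mem_ball_self hr) hz, rfl⟩
  filter_upwards [Φ.open_source.mem_nhds hzΦ,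
    (Φ.continuousAt hzΦ).preimage_mem_nhds (Metric.ball_mem_nhds _ hr)] with x hx hxr
  exact ⟨fun hxC => hD.subset_connectedComponentIn hzD hDC ⟨x, hmemD hx hxr hxC, rfl⟩,
    fun hxC => connectedComponentIn_subset C (g z) hxC⟩

end Submanifolds

section MorseCalculus

variable {E : Type*} [NormedAddCommGroup E] [NormedSpace ℂ E] [NormedSpace ℝ E]
  [IsScalarTower ℝ ℂ E] {f : E → ℂ} {φ : E → ℝ} {z v : E}

theorem fderiv_fderiv_log_of_fderiv_eq_zero {F : Type*} [NormedAddCommGroup F] [NormedSpace ℝ F]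
    {g : F → ℝ} {x : F} (hg : ContDiff ℝ 2 g) (hx : g x ≠ 0) (hcrit : fderiv ℝ g x = 0) :
    fderiv ℝ (fderiv ℝ fun y => Real.log (g y)) x = (g x)⁻¹ • fderiv ℝ (fderiv ℝ g) x := by
  have hdiff : Differentiable ℝ g := hg.differentiable two_ne_zero
  have hlog : (fderiv ℝ fun y => Real.log (g y)) =ᶠ[𝓝 x] fun y => (g y)⁻¹ • fderiv ℝ g y := by
    filter_upwards [hg.continuous.continuousAt.eventually_ne hx] with y hy
    exact ((hdiff y).hasFDerivAt.log hy).fderiv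
  have hinv : DifferentiableAt ℝ (fun y => (g y)⁻¹) x := (hdiff x).inv hx
  have hfderiv : Differentiable ℝ (fderiv ℝ g) :=
    (hg.fderiv_right (m := 1) (by norm_num)).differentiable one_ne_zero
  rw [hlog.fderiv_eq, (hinv.hasFDerivAt.fun_smul (hfderiv x).hasFDerivAt).fderiv, hcrit]
  ext
  simp

/-- Taking real parts, as an isomorphism from complex to real linear forms. -/
def reForm : (E →L[ℂ] ℂ) ≃L[ℝ] (E →L[ℝ] ℝ) := StrongDual.extendRCLikeL.symm

theorem reForm_apply (α : E →L[ℂ] ℂ) (v : E) : reForm α v = (α v).re := rfl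

theorem reForm_smul_eq_zero_iff {c : ℂ} {α : E →L[ℂ] ℂ} :
    reForm (c • α) = 0 ↔ c = 0 ∨ α = 0 :=
  EmbeddingLike.map_eq_zero_iff.trans (smul_eq_zero (R := ℂ) (M := E →L[ℂ] ℂ))

/-- The `(1,0)`-part `∂g` of the differential of a real function `g`, as a complex linear form:
the form with real part `dg / 2`. -/
def delForm (g : E → ℝ) (z : E) : E →L[ℂ] ℂ := (2⁻¹ : ℝ) • reForm.symm (fderiv ℝ g z)

theorem two_mul_re_delForm (g : E → ℝ) (z v : E) : 2 * (delForm g z v).re = fderiv ℝ g z v := by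
  have hre : reForm (delForm g z) = (2⁻¹ : ℝ) • fderiv ℝ g z := by simp [delForm]
  rw [← reForm_apply, hre]
  simp

theorem contDiff_delForm {g : E → ℝ} (hg : ContDiff ℝ ∞ g) : ContDiff ℝ ∞ (delForm g) :=
  contDiff_const.fun_smul (reForm.symm.contDiff.comp (hg.fderiv_right (m := ∞) (by simp)))

/-- The Chern connection form: `∇(f e) = (df - f ∂φ) ⊗ e` for a holomorphic function `f` and a
frame `e` with `|e|² = exp (-φ)`. -/
def chernForm (f : E → ℂ) (φ : E → ℝ) (z : E) : E →L[ℂ] ℂ := fderiv ℂ f z - f z • delForm φ z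

theorem contDiff_chernForm (hf : ContDiff ℂ ∞ f) (hφ : ContDiff ℝ ∞ φ) :
    ContDiff ℝ ∞ (chernForm f φ) :=
  ((hf.fderiv_right (m := ∞) (by simp)).restrict_scalars ℝ).sub
    ((hf.restrict_scalars ℝ).smul (contDiff_delForm hφ))

/-- The function `|f e|² = |f|² exp (-φ)`. -/
def weightedNormSq (f : E → ℂ) (φ : E → ℝ) (z : E) : ℝ := ‖f z‖ ^ 2 * Real.exp (-φ z)

theorem contDiff_weightedNormSq (hf : ContDiff ℂ ∞ f) (hφ : ContDiff ℝ ∞ φ) :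
    ContDiff ℝ ∞ (weightedNormSq f φ) :=
  ((hf.restrict_scalars ℝ).norm_sq ℝ).mul hφ.neg.exp

/-- The coefficient of `∇(f e)` in `d|f e|² = Re (2 exp (-φ) f̄ ∇(f e))`. -/
def chernCoeff (f : E → ℂ) (φ : E → ℝ) (z : E) : ℂ := (2 * Real.exp (-φ z)) • starRingEnd ℂ (f z)

theorem chernCoeff_eq_zero_iff {X : Type*} {f : X → ℂ} {φ : X → ℝ} {x : X} :
    chernCoeff f φ x = 0 ↔ f x = 0 := by
  simp [chernCoeff]

theorem hasFDerivAt_chernCoeff (hf : DifferentiableAt ℂ f z) (hφ : DifferentiableAt ℝ φ z) :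
    HasFDerivAt (chernCoeff f φ)
      ((2 * Real.exp (-φ z)) •
          (Complex.conjCLE : ℂ →L[ℝ] ℂ).comp ((fderiv ℂ f z).restrictScalars ℝ) +
        ((2 : ℝ) • Real.exp (-φ z) • -fderiv ℝ φ z).smulRight (starRingEnd ℂ (f z))) z :=
  ((hφ.hasFDerivAt.fun_neg.exp).const_mul 2).fun_smul
    (Complex.conjCLE.hasFDerivAt.comp z (hf.hasFDerivAt.restrictScalars ℝ))

theorem fderiv_chernCoeff_eq_zero_iff (hf : DifferentiableAt ℂ f z) (hφ : DifferentiableAt ℝ φ z)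
    (hz : f z = 0) : fderiv ℝ (chernCoeff f φ) z v = 0 ↔ fderiv ℂ f z v = 0 := by
  rw [(hasFDerivAt_chernCoeff hf hφ).fderiv, hz]
  simp

theorem fderiv_weightedNormSq (hf : DifferentiableAt ℂ f z) (hφ : DifferentiableAt ℝ φ z) :
    fderiv ℝ (weightedNormSq f φ) z = reForm (chernCoeff f φ z • chernForm f φ z) := by
  have hderiv := ((hf.hasFDerivAt.restrictScalars ℝ).norm_sq).mul hφ.hasFDerivAt.fun_neg.exp
  rw [show fderiv ℝ (weightedNormSq f φ) z = _ from hderiv.fderiv]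
  ext v
  simp only [reForm_apply, chernCoeff, chernForm, ← two_mul_re_delForm, Complex.inner,
    Complex.sq_norm, Complex.normSq_apply, add_apply, smul_apply, neg_apply, sub_apply,
    ContinuousLinearMap.comp_apply, ContinuousLinearMap.coe_restrictScalars', innerSL_apply_apply,
    smul_eq_mul, nsmul_eq_mul, Nat.cast_ofNat, Complex.real_smul, Complex.mul_re, Complex.mul_im,
    Complex.sub_re, Complex.sub_im, Complex.conj_re, Complex.conj_im, Complex.ofReal_re,
    Complex.ofReal_im]
  ring

theorem fderiv_weightedNormSq_eq_zero_iff (hf : DifferentiableAt ℂ f z)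
    (hφ : DifferentiableAt ℝ φ z) :
    fderiv ℝ (weightedNormSq f φ) z = 0 ↔ f z = 0 ∨ chernForm f φ z = 0 := by
  rw [fderiv_weightedNormSq hf hφ, reForm_smul_eq_zero_iff, chernCoeff_eq_zero_iff]

theorem fderiv_fderiv_weightedNormSq (hf : ContDiff ℂ ∞ f) (hφ : ContDiff ℝ ∞ φ) (z v : E) :
    fderiv ℝ (fderiv ℝ (weightedNormSq f φ)) z v = reForm (chernCoeff f φ z •
      fderiv ℝ (chernForm f φ) z v + fderiv ℝ (chernCoeff f φ) z v • chernForm f φ z) := by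
  have hf' : Differentiable ℂ f := hf.differentiable (by simp)
  have hφ' : Differentiable ℝ φ := hφ.differentiable (by simp)
  have hcoeff := (hasFDerivAt_chernCoeff (hf' z) (hφ' z)).differentiableAt.hasFDerivAt
  have hform := ((contDiff_chernForm hf hφ).differentiable (by simp) z).hasFDerivAt
  have hfderiv :
      fderiv ℝ (weightedNormSq f φ) = fun x => reForm (chernCoeff f φ x • chernForm f φ x) :=
    funext fun x => fderiv_weightedNormSq (hf' x) (hφ' x)
  rw [hfderiv, show fderiv ℝ (fun x => reForm (chernCoeff f φ x • chernForm f φ x)) z = _ from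
    (reForm.hasFDerivAt.comp z (hcoeff.fun_smul hform)).fderiv]
  simp

theorem fderiv_fderiv_weightedNormSq_eq_zero_iff_of_eq_zero (hf : ContDiff ℂ ∞ f)
    (hφ : ContDiff ℝ ∞ φ) (hz : f z = 0) (hchern : chernForm f φ z ≠ 0) :
    fderiv ℝ (fderiv ℝ (weightedNormSq f φ)) z v = 0 ↔ fderiv ℂ f z v = 0 := by
  rw [fderiv_fderiv_weightedNormSq hf hφ, chernCoeff_eq_zero_iff.2 hz,
    zero_smul ℂ (_ : E →L[ℂ] ℂ), zero_add, reForm_smul_eq_zero_iff, or_iff_left hchern,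
    fderiv_chernCoeff_eq_zero_iff (hf.differentiable (by simp) z)
      (hφ.differentiable (by simp) z) hz]

theorem fderiv_fderiv_weightedNormSq_eq_zero_iff_of_chernForm_eq_zero (hf : ContDiff ℂ ∞ f)
    (hφ : ContDiff ℝ ∞ φ) (hz : f z ≠ 0) (hchern : chernForm f φ z = 0) :
    fderiv ℝ (fderiv ℝ (weightedNormSq f φ)) z v = 0 ↔ fderiv ℝ (chernForm f φ) z v = 0 := by
  rw [fderiv_fderiv_weightedNormSq hf hφ, hchern, smul_zero (M := ℂ) (A := E →L[ℂ] ℂ),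
    add_zero, reForm_smul_eq_zero_iff, or_iff_right (chernCoeff_eq_zero_iff.not.2 hz)]

end MorseCalculus

section Charts

variable {n : ℕ}

theorem contDiff_affineLift (i k : Fin (n + 1)) :
    ContDiff ℂ ∞ fun z : Fin n → ℂ => (affineLift i z).1 k := by
  refine Fin.succAboveCases i ?_ (fun k => ?_) k
  · simpa [affineLift] using contDiff_const
  · simpa [affineLift] using contDiff_apply ℂ ℂ k

theorem continuous_mk : Continuous fun Z : Punctured n => (Projectivization.mk ℂ Z.1 Z.2 : CP n) :=
  continuous_coinduced_rng

theorem affinePt_eq_mk_iff (i : Fin (n + 1)) (z : Fin n → ℂ) (Z : Punctured n) :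
    affinePt i z = Projectivization.mk ℂ Z.1 Z.2 ↔
      Z.1 i ≠ 0 ∧ z = fun k => (Z.1 i)⁻¹ * Z.1 (i.succAbove k) := by
  rw [affinePt, Projectivization.mk_eq_mk_iff']
  constructor
  · rintro ⟨a, ha⟩
    have h1 : a * Z.1 i = 1 := by simpa [affineLift] using congrFun ha i
    have h2 : Z.1 i ≠ 0 := right_ne_zero_of_mul_eq_one h1
    refine ⟨h2, funext fun k => ?_⟩
    have h3 := congrFun ha (i.succAbove k)
    simp only [Pi.smul_apply, smul_eq_mul, affineLift, Fin.insertNth_apply_succAbove] at h3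
    rw [← h3, eq_inv_of_mul_eq_one_left h1]
  · rintro ⟨h, rfl⟩
    refine ⟨(Z.1 i)⁻¹, funext fun j => ?_⟩
    refine Fin.succAboveCases i ?_ (fun k => ?_) j
    · simp [affineLift, h]
    · simp [affineLift]

theorem continuous_affinePt (i : Fin (n + 1)) : Continuous (affinePt (n := n) i) := by
  refine continuous_mk.comp (Continuous.subtype_mk (continuous_pi fun k => ?_) _)
  exact (contDiff_affineLift i k).continuous

theorem isOpenMap_affinePt (i : Fin (n + 1)) : IsOpenMap (affinePt (n := n) i) := by
  intro W hW
  refine isOpen_coinduced.2 ?_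
  have h : (fun Z : Punctured n => (Projectivization.mk ℂ Z.1 Z.2 : CP n)) ⁻¹' (affinePt i '' W) =
      {Z : Punctured n | Z.1 i ≠ 0 ∧ (fun k => (Z.1 i)⁻¹ * Z.1 (i.succAbove k)) ∈ W} := by
    ext Z
    simp only [Set.mem_preimage, Set.mem_image, Set.mem_ofPred_eq, affinePt_eq_mk_iff]
    constructor
    · rintro ⟨z, hz, h, rfl⟩
      exact ⟨h, hz⟩
    · rintro ⟨h, hz⟩
      exact ⟨_, hz, h, rfl⟩
  rw [h]
  have hc : ∀ k, Continuous fun Z : Punctured n => Z.1 k := fun k =>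
    (continuous_apply k).comp continuous_subtype_val
  have ho : IsOpen {Z : Punctured n | Z.1 i ≠ 0} := isOpen_ne_fun (hc i) continuous_const
  refine ContinuousOn.isOpen_inter_preimage (f := fun Z : Punctured n =>
    (fun k => (Z.1 i)⁻¹ * Z.1 (i.succAbove k))) ?_ ho hW
  exact continuousOn_pi.2 fun k =>
    ((hc i).continuousOn.inv₀ fun Z hZ => hZ).mul (hc _).continuousOn

theorem exists_affinePt_eq (p : CP n) : ∃ i z, affinePt i z = p := by
  induction p using Projectivization.ind with
  | h Z hZ =>
    obtain ⟨i, hi⟩ : ∃ i, Z i ≠ 0 := by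
      by_contra! h
      exact hZ (funext h)
    exact ⟨i, _, (affinePt_eq_mk_iff i _ ⟨Z, hZ⟩).2 ⟨hi, rfl⟩⟩

end Charts

section LocalExpressions

variable {n m : ℕ}

theorem one_add_sum_norm_sq_pos (z : Fin n → ℂ) : 0 < 1 + ∑ j, ‖z j‖ ^ 2 := by positivity

theorem contDiff_potential : ContDiff ℝ ∞ (potential (n := n) m) := by
  have hsum : ContDiff ℝ ∞ fun z : Fin n → ℂ => 1 + ∑ j, ‖z j‖ ^ 2 :=
    contDiff_const.add (ContDiff.sum fun j _ => (contDiff_apply ℝ ℂ j).norm_sq ℝ)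
  exact contDiff_const.mul (hsum.log fun z => (one_add_sum_norm_sq_pos z).ne')

theorem differentiable_potential : Differentiable ℝ (potential (n := n) m) :=
  contDiff_potential.differentiable (by simp)

theorem exp_neg_potential (z : Fin n → ℂ) :
    Real.exp (-potential m z) = ((1 + ∑ j, ‖z j‖ ^ 2) ^ m)⁻¹ := by
  rw [potential, Real.exp_neg, mul_comm, Real.exp_mul, Real.exp_log (one_add_sum_norm_sq_pos z),
    Real.rpow_natCast]

theorem inChart_normSq (s : H0 n m) (i : Fin (n + 1)) :
    inChart (normSq s) i = weightedNormSq (localExpr s i) (potential m) := by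
  funext z
  have hsum : ∑ k, ‖(affineLift i z).1 k‖ ^ 2 = 1 + ∑ j, ‖z j‖ ^ 2 := by
    rw [Fin.sum_univ_succAbove _ i]
    simp [affineLift]
  rw [weightedNormSq, exp_neg_potential, ← div_eq_mul_inv, ← hsum]
  rfl

theorem differentiable_localExpr (s : H0 n m) (i : Fin (n + 1)) :
    Differentiable ℂ (localExpr s i) :=
  s.2.2 i

theorem contDiff_localExpr (s : H0 n m) (i : Fin (n + 1)) : ContDiff ℂ ∞ (localExpr s i) :=
  contDiff_of_differentiable (differentiable_localExpr s i)

theorem contDiff_inChart_normSq (s : H0 n m) (i : Fin (n + 1)) :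
    ContDiff ℝ ∞ (inChart (normSq s) i) := by
  rw [inChart_normSq]
  exact contDiff_weightedNormSq (contDiff_localExpr s i) contDiff_potential

/-- The coefficient of `eᵢ` in `∇s` over `Uᵢ`, as a complex linear form on tangent vectors. -/
def covDeriv (s : H0 n m) (i : Fin (n + 1)) : (Fin n → ℂ) → (Fin n → ℂ) →L[ℂ] ℂ :=
  chernForm (localExpr s i) (potential m)

theorem contDiff_covDeriv (s : H0 n m) (i : Fin (n + 1)) : ContDiff ℝ ∞ (covDeriv s i) :=
  contDiff_chernForm (contDiff_localExpr s i) contDiff_potential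

theorem continuous_covDeriv (s : H0 n m) (i : Fin (n + 1)) : Continuous (covDeriv s i) :=
  (contDiff_covDeriv s i).continuous

theorem del_eq_delForm (g : (Fin n → ℂ) → ℝ) (z v : Fin n → ℂ) : del g z v = delForm g z v := by
  rw [del, ← two_mul_re_delForm, ← two_mul_re_delForm, map_smul]
  apply Complex.ext <;> simp

theorem nabla_eq_covDeriv (s : H0 n m) (i : Fin (n + 1)) (z v : Fin n → ℂ) :
    nabla s i z v = covDeriv s i z v := by
  have hfderiv := ((differentiable_localExpr s i z).hasFDerivAt.restrictScalars ℝ).fderiv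
  rw [nabla, hfderiv, del_eq_delForm]
  rfl

theorem IsCriticalPoint.covDeriv_eq_zero {s : H0 n m} {i : Fin (n + 1)} {z : Fin n → ℂ}
    (h : IsCriticalPoint s (affinePt i z)) : covDeriv s i z = 0 := by
  ext v
  rw [← nabla_eq_covDeriv]
  exact h i z rfl v

theorem mem_critSet_normSq_iff {s : H0 n m} {p : CP n} :
    p ∈ critSet (normSq s) ↔
      ∀ i z, affinePt i z = p → localExpr s i z = 0 ∨ covDeriv s i z = 0 := by
  simp only [critSet, Set.mem_ofPred_eq, inChart_normSq,
    fderiv_weightedNormSq_eq_zero_iff (differentiable_localExpr _ _ _)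
    (differentiable_potential _)]
  rfl

theorem normSq_affinePt_eq_zero_iff {s : H0 n m} {i : Fin (n + 1)} {z : Fin n → ℂ} :
    normSq s (affinePt i z) = 0 ↔ localExpr s i z = 0 := by
  rw [show normSq s (affinePt i z) = inChart (normSq s) i z from rfl, inChart_normSq]
  simp [weightedNormSq]

theorem affinePt_mem_critSet_of_localExpr_eq_zero {s : H0 n m} {i : Fin (n + 1)} {z : Fin n → ℂ}
    (h : localExpr s i z = 0) : affinePt i z ∈ critSet (normSq s) :=
  mem_critSet_normSq_iff.2 fun j w hw => Or.inl <| by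
    rwa [← normSq_affinePt_eq_zero_iff, hw, normSq_affinePt_eq_zero_iff]

end LocalExpressions

section GenericSections

open Module Function

variable {n m : ℕ}

/-- The value and the covariant derivative of a section at a point of `Uᵢ`. -/
def jet (i : Fin (n + 1)) (z : Fin n → ℂ) : H0 n m →ₗ[ℂ] ℂ × ((Fin n → ℂ) →L[ℂ] ℂ) where
  toFun s := (localExpr s i z, covDeriv s i z)
  map_add' s t := by
    have h : localExpr (s + t) i = fun z => localExpr s i z + localExpr t i z := rfl
    simp only [covDeriv, chernForm, h]
    rw [fderiv_fun_add (differentiable_localExpr s i z) (differentiable_localExpr t i z)]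
    refine Prod.ext rfl (ContinuousLinearMap.ext fun v => ?_)
    simp only [sub_apply, add_apply, smul_apply, smul_eq_mul, Prod.mk_add_mk]
    ring
  map_smul' c s := by
    have h : localExpr (c • s) i = fun z => c • localExpr s i z := rfl
    simp only [covDeriv, chernForm, h]
    rw [fderiv_fun_const_smul (differentiable_localExpr s i z)]
    refine Prod.ext rfl (ContinuousLinearMap.ext fun v => ?_)
    simp only [sub_apply, smul_apply, smul_eq_mul, Prod.smul_mk, RingHom.id_apply]
    ring

theorem contDiff_jet_apply (i : Fin (n + 1)) (s : H0 n m) : ContDiff ℝ ∞ fun z => jet i z s :=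
  ((contDiff_localExpr s i).restrict_scalars ℝ).prodMk (contDiff_covDeriv s i)

/-- The section `Zᵢ^{m-1} (∑ aⱼ Zⱼ + b Zᵢ)`, whose local expression over `Uᵢ` is `a z + b`. -/
def affineSection (hm : 1 ≤ m) (i : Fin (n + 1)) (a : (Fin n → ℂ) →L[ℂ] ℂ) (b : ℂ) : H0 n m :=
  ⟨fun Z => Z.1 i ^ (m - 1) * (a (fun k => Z.1 (i.succAbove k)) + b * Z.1 i), by
    refine ⟨fun c hc Z => ?_, fun l => ?_⟩
    · have h : (a fun k => c * Z.1 (i.succAbove k)) = c * a fun k => Z.1 (i.succAbove k) :=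
        a.map_smul c _
      obtain ⟨m, rfl⟩ := Nat.exists_eq_add_of_le' hm
      simp only [Pi.smul_apply, smul_eq_mul, Nat.add_sub_cancel, h]
      ring
    · have hcoord (k) := (contDiff_affineLift (n := n) l k).differentiable (by simp)
      have hrest : Differentiable ℂ fun z : Fin n → ℂ =>
          fun k => (affineLift l z).1 (i.succAbove k) := differentiable_pi.2 fun k => hcoord _
      exact ((hcoord i).pow _).mul ((a.differentiable.comp hrest).add ((hcoord i).const_mul _))⟩

theorem localExpr_affineSection (hm : 1 ≤ m) (i : Fin (n + 1)) (a : (Fin n → ℂ) →L[ℂ] ℂ) (b : ℂ) :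
    localExpr (affineSection hm i a b) i = fun z => a z + b := by
  funext z
  simp [localExpr, affineSection, affineLift]

theorem jet_surjective (hm : 1 ≤ m) (i : Fin (n + 1)) (z : Fin n → ℂ) :
    Surjective (jet (m := m) i z) := by
  rintro ⟨c, α⟩
  let a : (Fin n → ℂ) →L[ℂ] ℂ := α + c • delForm (potential m) z
  refine ⟨affineSection hm i a (c - a z), Prod.ext ?_ ?_⟩
  · simp [jet, localExpr_affineSection]
  · have hfderiv : fderiv ℂ (fun y => a y + (c - a z)) z = a := (a.hasFDerivAt.add_const _).fderiv
    simp only [jet, LinearMap.coe_mk, AddHom.coe_mk, covDeriv, chernForm, localExpr_affineSection,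
      hfderiv, add_sub_cancel]
    exact add_sub_cancel_right _ _

theorem finrank_real_continuousDual (E : Type*) [NormedAddCommGroup E] [NormedSpace ℂ E]
    [FiniteDimensional ℂ E] : finrank ℝ (E →L[ℂ] ℂ) = finrank ℝ E := by
  rw [finrank_real_of_complex, finrank_real_of_complex,
    ← (LinearMap.toContinuousLinearMap (𝕜 := ℂ) (E := E) (F' := ℂ)).finrank_eq]
  exact congrArg (2 * ·) Subspace.dual_finrank_eq

/-- Over `Uᵢ`, the zeros of `∇s` are non-degenerate and are not zeros of `s`. -/
def IsRegularOn (s : H0 n m) (i : Fin (n + 1)) : Prop :=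
  ∀ z, covDeriv s i z = 0 → localExpr s i z ≠ 0 ∧ Bijective (fderiv ℝ (covDeriv s i) z)

theorem isLebesgueNull_exists_jet_eq_zero (hm : 1 ≤ m) (i : Fin (n + 1)) :
    IsLebesgueNull {s : H0 n m | ∃ z, jet i z s = 0} := by
  have hfinrank : finrank ℝ (ℂ × ((Fin n → ℂ) →L[ℂ] ℂ)) = 2 + finrank ℝ (Fin n → ℂ) := by
    rw [finrank_prod, Complex.finrank_real_complex, finrank_real_continuousDual]
  refine (isLebesgueNull_not_surjective_fderiv (fun s => (contDiff_jet_apply i s).of_le (by simp))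
    (jet_surjective hm i) (by lia)).mono ?_
  rintro s ⟨z, hz⟩ hreg
  have := LinearMap.finrank_le_finrank_of_surjective (hreg z hz)
  lia

theorem isLebesgueNull_not_isRegularOn (hm : 1 ≤ m) (i : Fin (n + 1)) :
    IsLebesgueNull {s : H0 n m | ¬ IsRegularOn s i} := by
  have hfinrank := finrank_real_continuousDual (Fin n → ℂ)
  have hdegenerate := isLebesgueNull_not_surjective_fderiv
    (P := fun z => LinearMap.snd ℂ _ _ ∘ₗ jet (m := m) i z)
    (fun s => (contDiff_covDeriv s i).of_le (by simp))
    (fun z => Prod.snd_surjective.comp (jet_surjective hm i z)) hfinrank.ge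
  refine ((isLebesgueNull_exists_jet_eq_zero hm i).union hdegenerate).mono fun s hs => ?_
  by_contra hgood
  obtain ⟨hjet, hsurj⟩ := not_or.1 hgood
  refine hs fun z hz => ⟨fun h0 => hjet ⟨z, Prod.ext h0 hz⟩, ?_⟩
  have hsurj_z := not_not.1 hsurj z hz
  have hinj := (LinearMap.injective_iff_surjective_of_finrank_eq_finrank hfinrank.symm).2 hsurj_z
  exact ⟨hinj, hsurj_z⟩

end GenericSections

section CriticalSet

open Function

variable {n m : ℕ} {s : H0 n m} {i : Fin (n + 1)} {z : Fin n → ℂ}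

theorem forall_hessian_eq_zero_iff {f : CP n → ℝ} {v : Fin n → ℂ} :
    (∀ w, hessian f i z v w = 0) ↔ fderiv ℝ (fderiv ℝ (inChart f i)) z v = 0 :=
  (ContinuousLinearMap.ext_iff (g := 0)).symm

theorem IsRegularOn.eventually_covDeriv_ne_zero (hs : IsRegularOn s i) (hz : covDeriv s i z = 0) :
    ∀ᶠ x in 𝓝[≠] z, covDeriv s i x ≠ 0 := by
  have hderiv := ((contDiff_covDeriv s i).differentiable (by simp) z).hasFDerivAt
  obtain ⟨K, -, hK⟩ := LinearMap.exists_antilipschitzWith (fderiv ℝ (covDeriv s i) z).toLinearMap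
    (LinearMap.ker_eq_bot.2 (hs z hz).2.1)
  exact hderiv.eventually_ne ⟨K, hK⟩

theorem isIsolatedCritical_of_isRegularOn (hs : ∀ i, IsRegularOn s i) {p : CP n}
    (hp : IsCriticalPoint s p) : IsIsolatedCritical s p := by
  obtain ⟨i, z, rfl⟩ := exists_affinePt_eq p
  have hne := eventually_nhdsWithin_iff.1 ((hs i).eventually_covDeriv_ne_zero hp.covDeriv_eq_zero)
  refine ⟨_, (isOpenMap_affinePt i).image_mem_nhds hne, ?_⟩
  rintro _ ⟨x, hx, rfl⟩ hq
  by_contra hxz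
  exact hx (ne_of_apply_ne (affinePt i) hxz) hq.covDeriv_eq_zero

theorem fderiv_fderiv_normSq_eq_zero_iff_of_covDeriv_eq_zero (h0 : localExpr s i z ≠ 0)
    (hz : covDeriv s i z = 0) {v : Fin n → ℂ} :
    fderiv ℝ (fderiv ℝ (inChart (normSq s) i)) z v = 0 ↔ fderiv ℝ (covDeriv s i) z v = 0 := by
  rw [inChart_normSq]
  exact fderiv_fderiv_weightedNormSq_eq_zero_iff_of_chernForm_eq_zero (contDiff_localExpr s i)
    contDiff_potential h0 hz

theorem isNondegenerateCritical_of_isRegularOn (hs : ∀ i, IsRegularOn s i) {p : CP n}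
    (hp : IsCriticalPoint s p) : IsNondegenerateCritical s p := by
  have hne : normSq s p ≠ 0 := by
    obtain ⟨i, z, rfl⟩ := exists_affinePt_eq p
    exact normSq_affinePt_eq_zero_iff.not.2 (hs i z hp.covDeriv_eq_zero).1
  refine ⟨hp, hne, ?_⟩
  rintro i z rfl v hv
  obtain ⟨h0, hbij⟩ := hs i z hp.covDeriv_eq_zero
  change inChart (normSq s) i z ≠ 0 at hne
  have hcrit : fderiv ℝ (inChart (normSq s) i) z = 0 := by
    rw [inChart_normSq]
    exact (fderiv_weightedNormSq_eq_zero_iff (differentiable_localExpr s i z)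
      (differentiable_potential z)).2 (Or.inr hp.covDeriv_eq_zero)
  have hlog := fderiv_fderiv_log_of_fderiv_eq_zero
    (contDiff_infty.1 (contDiff_inChart_normSq s i) 2) hne hcrit
  have hv' : (inChart (normSq s) i z)⁻¹ • fderiv ℝ (fderiv ℝ (inChart (normSq s) i)) z v = 0 :=
    (DFunLike.congr_fun hlog v).symm.trans (forall_hessian_eq_zero_iff.1 hv)
  rw [smul_eq_zero_iff_right (inv_ne_zero hne),
    fderiv_fderiv_normSq_eq_zero_iff_of_covDeriv_eq_zero h0 hp.covDeriv_eq_zero] at hv'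
  exact hbij.1 (hv'.trans (map_zero _).symm)

/-- The Morse–Bott condition at the point of `Uᵢ` with coordinates `z`: near it, the critical set
of `f` is a submanifold tangent to the null space of the Hessian. -/
def IsMorseBottAt (f : CP n → ℝ) (i : Fin (n + 1)) (z : Fin n → ℂ) : Prop :=
  ∃ T, IsSubmanifoldAt (affinePt i ⁻¹' critSet f) z T ∧ ∀ v, (∀ w, hessian f i z v w = 0) ↔ v ∈ T

theorem isMorseBottAt_normSq_of_localExpr_eq_zero (h0 : localExpr s i z = 0)
    (hz : covDeriv s i z ≠ 0) :
    IsMorseBottAt (normSq s) i z := by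
  have hf := contDiff_localExpr s i
  have hfderiv := ((differentiable_localExpr s i z).hasFDerivAt.restrictScalars ℝ).fderiv
  have hne : fderiv ℂ (localExpr s i) z ≠ 0 := by
    intro hf0
    rw [covDeriv, chernForm, hf0, h0, zero_smul ℂ (_ : (Fin n → ℂ) →L[ℂ] ℂ), sub_zero] at hz
    exact hz rfl
  have hsurj : Surjective (fderiv ℝ (localExpr s i) z) := by
    rw [hfderiv]
    exact LinearMap.surjective (ContinuousLinearMap.coe_injective.ne hne)
  have hS : {x | localExpr s i x = 0} =ᶠ[𝓝 z] affinePt i ⁻¹' critSet (normSq s) := by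
    refine Filter.eventuallyEq_set.2 ?_
    filter_upwards [(continuous_covDeriv s i).continuousAt.eventually_ne hz] with x hx
    exact ⟨affinePt_mem_critSet_of_localExpr_eq_zero,
      fun h => (mem_critSet_normSq_iff.1 h i x rfl).resolve_right hx⟩
  refine ⟨_, (isSubmanifoldAt_zeroSet (hf.restrict_scalars ℝ) h0 hsurj).congr hS, fun v => ?_⟩
  rw [forall_hessian_eq_zero_iff, inChart_normSq,
    fderiv_fderiv_weightedNormSq_eq_zero_iff_of_eq_zero hf contDiff_potential h0 hz, hfderiv]
  rfl

theorem IsRegularOn.isMorseBottAt_of_covDeriv_eq_zero (hs : IsRegularOn s i)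
    (hz : covDeriv s i z = 0) (hcrit : affinePt i z ∈ critSet (normSq s)) :
    IsMorseBottAt (normSq s) i z := by
  obtain ⟨h0, hbij⟩ := hs z hz
  have hS : {x | covDeriv s i x = 0} =ᶠ[𝓝 z] affinePt i ⁻¹' critSet (normSq s) := by
    refine Filter.eventuallyEq_set.2 ?_
    filter_upwards [(differentiable_localExpr s i).continuous.continuousAt.eventually_ne h0,
      eventually_nhdsWithin_iff.1 (hs.eventually_covDeriv_ne_zero hz)] with x hx hxz
    refine ⟨fun h => ?_, fun h => (mem_critSet_normSq_iff.1 h i x rfl).resolve_left hx⟩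
    rwa [Set.mem_preimage, of_not_not fun hne => hxz hne h]
  refine ⟨_, (isSubmanifoldAt_zeroSet (contDiff_covDeriv s i) hz hbij.2).congr hS, fun v => ?_⟩
  rw [forall_hessian_eq_zero_iff, fderiv_fderiv_normSq_eq_zero_iff_of_covDeriv_eq_zero h0 hz]
  rfl

theorem IsRegularOn.isMorseBottAt (hs : IsRegularOn s i)
    (hcrit : affinePt i z ∈ critSet (normSq s)) :
    IsMorseBottAt (normSq s) i z := by
  by_cases hz : covDeriv s i z = 0
  · exact hs.isMorseBottAt_of_covDeriv_eq_zero hz hcrit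
  · exact isMorseBottAt_normSq_of_localExpr_eq_zero
      ((mem_critSet_normSq_iff.1 hcrit i z rfl).resolve_right hz) hz

theorem isGeneralizedMorse_of_isRegularOn (hs : ∀ i, IsRegularOn s i) :
    IsGeneralizedMorse (normSq s) := by
  refine ⟨contDiff_inChart_normSq s, fun p hp =>
    ⟨isConnected_connectedComponentIn_iff.2 hp, connectedComponentIn_subset _ _,
      fun i z hz => ?_⟩⟩
  obtain ⟨T, hT, hnull⟩ :=
    (hs i).isMorseBottAt (connectedComponentIn_subset _ _ hz)
  rw [connectedComponentIn_eq hz]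
  exact ⟨T, hT.preimage_connectedComponentIn (continuous_affinePt i), hnull⟩

end CriticalSet

end FubiniStudy

end

theorem theorem1p4 (n m : ℕ) (hm : 1 ≤ m) :
    ∃ S : Set (FubiniStudy.H0 n m), FubiniStudy.IsLebesgueNull S ∧
      ∀ s : FubiniStudy.H0 n m, s ∉ S →
        (∀ p : FubiniStudy.CP n, FubiniStudy.IsCriticalPoint s p →
          FubiniStudy.IsNondegenerateCritical s p ∧ FubiniStudy.IsIsolatedCritical s p) ∧
        FubiniStudy.IsGeneralizedMorse (FubiniStudy.normSq s) := by
  refine ⟨⋃ i, {s | ¬ FubiniStudy.IsRegularOn s i},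
    .iUnion fun i => FubiniStudy.isLebesgueNull_not_isRegularOn hm i, fun s hs => ?_⟩
  have hreg : ∀ i, FubiniStudy.IsRegularOn s i := by simpa using hs
  exact ⟨fun p hp => ⟨FubiniStudy.isNondegenerateCritical_of_isRegularOn hreg hp,
    FubiniStudy.isIsolatedCritical_of_isRegularOn hreg hp⟩,
    FubiniStudy.isGeneralizedMorse_of_isRegularOn hreg⟩
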